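/- Let $\mathbf{H}^2$ be the hyperbolic plane (curvature $-1$), on which $\mathrm{PSL}(2,\mathbf{Z})$ acts by Möbius transformations, and let $X=\mathbf{H}^2/\mathrm{PSL}(2,\mathbf{Z})$ be the modular surface. Call $\gamma\in\mathrm{PSL}(2,\mathbf{Z})$ primitive if $\gamma\neq\eta^m$ for all $\eta\in\mathrm{PSL}(2,\mathbf{Z})$ and all integers $m\ge 2$. The primitive length spectrum $\mathcal{L}_p(X)$ is the set of lengths of closed orbifold geodesics on $X$ representing conjugacy classes of primitive elements, that is, the set of real $L>0$ for which there are a primitive $\gamma\in\mathrm{PSL}(2,\mathbf{Z})$ and a complete unit-speed geodesic $c\colon\mathbf{R}\to\mathbf{H}^2$ with $\gamma\cdot c(t)=c(t+L)$ for all $t\in\mathbf{R}$. Then for every $\ell\in\mathcal{L}_p(X)$ and every $k\in\mathbf{N}$ there is a positive integer $C_{\ell,k}$ such that \[ \{\,C_{\ell,k}\,n\,\ell : n=1,\dots,k\,\}\subset\mathcal{L}_p(X). \] -/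

import Mathlib

open scoped MatrixGroups UpperHalfPlane

namespace ModularSurface

/-- Central elements `±1` of `SL(2, ℤ)` act trivially on the upper half plane. -/
theorem smul_eq_of_mem_center {g : SL(2, ℤ)} (hg : g ∈ Subgroup.center SL(2, ℤ)) (z : ℍ) :
    g • z = z := by
  obtain ⟨r, hr, hrg⟩ := Matrix.SpecialLinearGroup.mem_center_iff.mp hg
  have hr2 : r = 1 ∨ r = -1 := by simpa using hr
  rcases hr2 with rfl | rfl
  · have : g = 1 := by ext i j; simp [← hrg]
    rw [this, one_smul]
  · have : g = -1 := by ext i j; simp [← hrg]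
    rw [this, ModularGroup.SL_neg_smul, one_smul]

/-- The homomorphism from `PSL(2, ℤ)` to the permutations of `ℍ` induced by Möbius
transformations. -/
noncomputable def pslToPerm : PSL(2, ℤ) →* Equiv.Perm ℍ :=
  QuotientGroup.lift (Subgroup.center SL(2, ℤ)) (MulAction.toPermHom SL(2, ℤ) ℍ)
    (fun _ hg => Equiv.ext fun z => smul_eq_of_mem_center hg z)

/-- `PSL(2, ℤ)` acts on the hyperbolic plane `ℍ` by Möbius transformations. The quotient orbifold
`X = ℍ / PSL(2, ℤ)` is the modular surface, with orbifold fundamental group `PSL(2, ℤ)`. -/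
noncomputable instance pslAction : MulAction PSL(2, ℤ) ℍ :=
  MulAction.compHom ℍ pslToPerm

theorem coe_smul (g : SL(2, ℤ)) (z : ℍ) : (g : PSL(2, ℤ)) • z = g • z := rfl

/-- A complete unit-speed geodesic of the hyperbolic plane. Geodesics of `ℍ` minimize length
globally, so these are exactly the isometric embeddings of the real line, `ℍ` carrying the
hyperbolic distance of curvature `-1`. -/
def IsGeodesicLine (c : ℝ → ℍ) : Prop := Isometry c

/-- The set of lengths of the closed orbifold geodesics of `X` that represent the conjugacy class
of `γ`. A closed orbifold geodesic of length `L > 0` representing the class of `γ` is the image in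
`X` of a unit-speed geodesic line `c` of the universal cover `ℍ` with `γ • c t = c (t + L)`.
Replacing `c` by `δ • c` replaces `γ` by `δ * γ * δ⁻¹`, so the set only depends on the conjugacy
class of `γ`. It is empty when `γ` is not hyperbolic. -/
def closedGeodesicLengths (γ : PSL(2, ℤ)) : Set ℝ :=
  {L | 0 < L ∧ ∃ c : ℝ → ℍ, IsGeodesicLine c ∧ ∀ t : ℝ, γ • c t = c (t + L)}

/-- `γ` is primitive: it is not a proper power of an element of the group. An element of finite
order `n` is never primitive, being its own `(n + 1)`-st power. -/
def IsPrimitiveElement {G : Type*} [Group G] (γ : G) : Prop :=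
  ∀ (η : G) (m : ℕ), 2 ≤ m → η ^ m ≠ γ

/-- The underlying set of the primitive length spectrum of the modular surface: the union of the
sets of lengths over all primitive conjugacy classes of `PSL(2, ℤ)`. -/
def primitiveLengthSpectrum : Set ℝ :=
  {L | ∃ γ : PSL(2, ℤ), IsPrimitiveElement γ ∧ L ∈ closedGeodesicLengths γ}

end ModularSurface

namespace ModularSurface

open Matrix

/-! `C = 1` works for all `ℓ` and `k`: every closed geodesic length, in particular `n * ℓ`, is
already the length of a primitive class. Length depends only on the trace, up to sign, and
`companion T` realises each trace with `|T| > 2`. It is primitive because its lower left entry is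
`1`: if `E ^ m = u • E - v • 1` has lower left entry `±1`, then `u = ±1`, which for `m ≥ 2` forces
`E` to be elliptic (`abs_trace_pow_le_two`). `companion_smul_affine` transfers the geodesic. -/

/-- A positive power of a `2 × 2` matrix `E` of determinant one is a combination `u • E - v • 1`;
the coefficient `u` grows with the exponent when `E` is not elliptic. -/
theorem exists_pow_succ_eq_smul_sub (E : Matrix (Fin 2) (Fin 2) ℤ) (hE : E.det = 1) (n : ℕ) :
    ∃ u v : ℤ, E ^ (n + 1) = u • E - v • (1 : Matrix (Fin 2) (Fin 2) ℤ) ∧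
      (2 ≤ |E.trace| → |v| < |u| ∧ (1 ≤ n → 1 < |u|)) := by
  induction n with
  | zero => exact ⟨1, 0, by simp, fun _ => by simp⟩
  | succ n ih =>
    obtain ⟨u, v, h, hgrow⟩ := ih
    refine ⟨E.trace * u - v, u, ?_, fun hs => ?_⟩
    · have hsq : E * E = E.trace • E - (1 : Matrix (Fin 2) (Fin 2) ℤ) := by
        rw [det_fin_two] at hE
        ext i j
        fin_cases i <;> fin_cases j <;>
          simp [Matrix.mul_apply, Fin.sum_univ_two, trace_fin_two, -zsmul_eq_mul] <;> linarith
      rw [pow_succ, h, sub_mul, smul_mul_assoc, hsq]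
      simp only [smul_mul_assoc, one_mul, smul_sub, sub_smul, smul_smul, mul_comm u]
      abel
    · obtain ⟨hvu, -⟩ := hgrow hs
      -- With the new coefficient `u' = E.trace * u - v`, this gives `|u'| ≥ 2|u| - |v| > |u| ≥ 1`.
      have h1 : |E.trace| * |u| ≤ |E.trace * u - v| + |v| := by
        rw [← abs_mul]; linarith [abs_sub_abs_le_abs_sub (E.trace * u) v]
      have h2 : 2 * |u| ≤ |E.trace| * |u| := by gcongr
      have h3 := abs_nonneg v
      exact ⟨by linarith, fun _ => by omega⟩

/-- A proper power of a matrix of determinant one that has lower left entry `±1` is not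
hyperbolic. -/
theorem abs_trace_pow_le_two {E : Matrix (Fin 2) (Fin 2) ℤ} (hE : E.det = 1) {m : ℕ} (hm : 2 ≤ m)
    (h : |(E ^ m) 1 0| = 1) : |(E ^ m).trace| ≤ 2 := by
  obtain ⟨n, rfl⟩ : ∃ n, m = n + 1 := ⟨m - 1, by omega⟩
  obtain ⟨u, v, hpow, hgrow⟩ := exists_pow_succ_eq_smul_sub E hE n
  have hu : |u| = 1 := by
    have : |u| * |E 1 0| = 1 := by
      rw [← h, ← abs_mul, hpow]
      simp [-zsmul_eq_mul, -zsmul_one]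
    exact Int.eq_one_of_mul_eq_one_right (abs_nonneg _) this
  have hu2 : u ^ 2 = 1 := by rw [← sq_abs, hu, one_pow]
  have hs : |E.trace| < 2 := by
    by_contra! hs
    have := (hgrow hs).2 (by omega)
    omega
  have hdet : (E ^ (n + 1)).det = 1 := by rw [det_pow, hE, one_pow]
  rw [det_fin_two] at hE
  rw [hpow, det_fin_two] at hdet
  simp only [Matrix.sub_apply, Matrix.smul_apply, smul_eq_mul, one_apply_eq, ne_eq, zero_ne_one, one_ne_zero,
    not_false_eq_true, one_apply_ne, mul_one, mul_zero, sub_zero] at hdet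
  rw [trace_fin_two] at hs
  have hs2 : (E 0 0 + E 1 1) ^ 2 < 2 ^ 2 := sq_lt_sq.mpr (by simpa using hs)
  have key : (E ^ (n + 1)).trace ^ 2 ≤ 2 ^ 2 := by
    rw [hpow, trace_fin_two]
    simp only [Matrix.sub_apply, Matrix.smul_apply, smul_eq_mul, one_apply_eq, mul_one]
    -- Discriminants: `u • E - v • 1` has `u ^ 2` times that of `E`, which is negative here.
    have : (u * E 0 0 - v + (u * E 1 1 - v)) ^ 2
        = u ^ 2 * ((E 0 0 + E 1 1) ^ 2 - 4) + 4 := by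
      linear_combination 4 * hdet - 4 * u ^ 2 * hE
    rw [this, hu2]
    linarith
  simpa using sq_le_sq.mp key

/-- The matrix `!![0, -1; 1, T]` with characteristic polynomial `X ^ 2 - T * X + 1`. -/
def companion (T : ℤ) : SL(2, ℤ) := ⟨!![0, -1; 1, T], by simp [det_fin_two]⟩

theorem coe_companion (T : ℤ) :
    (companion T : Matrix (Fin 2) (Fin 2) ℤ) = !![0, -1; 1, T] := rfl

theorem eq_or_eq_neg_of_psl_eq {g h : SL(2, ℤ)} (H : (g : PSL(2, ℤ)) = (h : PSL(2, ℤ))) :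
    g = h ∨ g = -h := by
  have hmem : g⁻¹ * h ∈ Subgroup.center SL(2, ℤ) := QuotientGroup.eq.mp H
  obtain ⟨r, hr, hrg⟩ := Matrix.SpecialLinearGroup.mem_center_iff.mp hmem
  have hr2 : r = 1 ∨ r = -1 := by simpa using hr
  rcases hr2 with rfl | rfl
  · have : g⁻¹ * h = 1 := by ext i j; rw [← hrg]; simp
    exact .inl (inv_mul_eq_one.mp this)
  · have : g⁻¹ * h = -1 := by ext i j; rw [← hrg]; simp
    rw [inv_mul_eq_iff_eq_mul] at this
    exact .inr (by rw [this]; simp)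

theorem isPrimitiveElement_companion {T : ℤ} (hT : 2 < |T|) :
    IsPrimitiveElement (companion T : PSL(2, ℤ)) := by
  intro η m hm h
  obtain ⟨E, rfl⟩ := QuotientGroup.mk_surjective η
  have hE : (E : Matrix (Fin 2) (Fin 2) ℤ) ^ m = !![0, -1; 1, T] ∨
      (E : Matrix (Fin 2) (Fin 2) ℤ) ^ m = -!![0, -1; 1, T] := by
    rw [← Matrix.SpecialLinearGroup.coe_pow, ← coe_companion, ← Matrix.SpecialLinearGroup.coe_neg]
    exact (eq_or_eq_neg_of_psl_eq (by rw [← h]; rfl)).imp (congrArg _) (congrArg _)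
  refine hT.not_ge ?_
  have htr := abs_trace_pow_le_two E.det_coe hm
    (by rcases hE with hE | hE <;> rw [hE] <;> simp)
  rcases hE with hE | hE <;> rw [hE] at htr <;> simpa [trace_fin_two] using htr

theorem coe_sl_smul (g : SL(2, ℤ)) (z : ℍ) :
    ((g • z : ℍ) : ℂ) = ((g 0 0 : ℤ) * z + (g 0 1 : ℤ)) / ((g 1 0 : ℤ) * z + (g 1 1 : ℤ)) := by
  simpa using UpperHalfPlane.coe_specialLinearGroup_apply g z

theorem sl_denom_ne_zero (g : SL(2, ℤ)) (z : ℍ) :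
    ((g 1 0 : ℤ) * z + (g 1 1 : ℤ) : ℂ) ≠ 0 := by
  simpa [ModularGroup.denom_apply] using UpperHalfPlane.denom_ne_zero (g : GL (Fin 2) ℝ) z

/-- The displacement of a point under a Möbius transformation. -/
theorem cosh_dist_smul (g : SL(2, ℤ)) (z : ℍ) :
    Real.cosh (dist z (g • z)) = 1 + ‖((g 1 0 : ℤ) * (z : ℂ) ^ 2 +
      ((g 1 1 : ℤ) - (g 0 0 : ℤ)) * z - (g 0 1 : ℤ))‖ ^ 2 / (2 * z.im ^ 2) := by
  have hd := sl_denom_ne_zero g z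
  have hz := z.im_ne_zero
  have hsub : (z : ℂ) - (g • z : ℍ) = ((g 1 0 : ℤ) * (z : ℂ) ^ 2 +
      ((g 1 1 : ℤ) - (g 0 0 : ℤ)) * z - (g 0 1 : ℤ)) / ((g 1 0 : ℤ) * z + (g 1 1 : ℤ)) := by
    rw [coe_sl_smul, eq_div_iff hd, sub_mul, div_mul_cancel₀ _ hd]
    ring
  have him : (g • z).im = z.im / ‖((g 1 0 : ℤ) * z + (g 1 1 : ℤ) : ℂ)‖ ^ 2 := by
    rw [ModularGroup.im_smul_eq_div_normSq, ModularGroup.denom_apply, Complex.normSq_eq_norm_sq]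
  rw [UpperHalfPlane.cosh_dist, dist_eq_norm, hsub, him, norm_div]
  have hd' := norm_ne_zero_iff.mpr hd
  field_simp

/-- An element translating a geodesic by `L > 0` is hyperbolic. -/
theorem two_lt_abs_trace {g : SL(2, ℤ)} {L : ℝ} (hL : 0 < L) {c : ℝ → ℍ} (hc : IsGeodesicLine c)
    (h : ∀ t, g • c t = c (t + L)) : 2 < |g 0 0 + g 1 1| := by
  have h1 := cosh_dist_smul g (c 0)
  have h2 := cosh_dist_smul (g * g) (c 0)
  have hd1 : dist (c 0) (g • c 0) = L := by
    rw [h, hc.dist_eq, zero_add, dist_zero_left, Real.norm_of_nonneg hL.le]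
  have hd2 : dist (c 0) ((g * g) • c 0) = 2 * L := by
    rw [mul_smul, h, h, hc.dist_eq, zero_add, ← two_mul, dist_zero_left,
      Real.norm_of_nonneg (by positivity)]
  rw [hd1] at h1
  rw [hd2] at h2
  have hent : ∀ i j, (g * g) i j = g i 0 * g 0 j + g i 1 * g 1 j := fun i j => by
    rw [Matrix.SpecialLinearGroup.coe_mul, Matrix.mul_apply, Fin.sum_univ_two]
  -- By Cayley–Hamilton, the fixed-point quadratic of `g * g` is the trace times that of `g`;
  -- comparing displacements `L` and `2 * L` then determines the trace.
  have hq : (((g * g) 1 0 : ℤ) * (c 0 : ℂ) ^ 2 + (((g * g) 1 1 : ℤ) - ((g * g) 0 0 : ℤ)) * c 0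
      - ((g * g) 0 1 : ℤ)) = ((g 0 0 + g 1 1 : ℤ) : ℝ) * ((g 1 0 : ℤ) * (c 0 : ℂ) ^ 2 +
      ((g 1 1 : ℤ) - (g 0 0 : ℤ)) * c 0 - (g 0 1 : ℤ)) := by
    simp only [hent]; push_cast; ring
  rw [hq, norm_mul, Complex.norm_real, mul_pow, Real.norm_eq_abs, sq_abs, mul_div_assoc] at h2
  have hcosh : 1 < Real.cosh L := Real.one_lt_cosh.mpr hL.ne'
  have h3 : Real.cosh (2 * L) - 1 = ((g 0 0 + g 1 1 : ℤ) : ℝ) ^ 2 * (Real.cosh L - 1) := by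
    rw [h2, h1]; ring
  rw [Real.cosh_two_mul, Real.sinh_sq] at h3
  have h4 : ((g 0 0 + g 1 1 : ℤ) : ℝ) ^ 2 = 2 * (Real.cosh L + 1) := by
    have : Real.cosh L - 1 ≠ 0 := by linarith
    apply mul_right_cancel₀ this
    linarith
  have h5 : (2 : ℤ) ^ 2 < (g 0 0 + g 1 1) ^ 2 := by
    have : ((2 : ℤ) : ℝ) ^ 2 < ((g 0 0 + g 1 1 : ℤ) : ℝ) ^ 2 := by rw [h4]; push_cast; linarith
    exact_mod_cast this
  simpa using sq_lt_sq.mp h5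

theorem lower_left_ne_zero {g : SL(2, ℤ)} (hg : 2 < |g 0 0 + g 1 1|) : g 1 0 ≠ 0 := by
  intro h0
  have hdet : g 0 0 * g 1 1 - g 0 1 * g 1 0 = 1 := by rw [← det_fin_two]; exact g.det_coe
  rw [h0, mul_zero, sub_zero] at hdet
  rcases Int.eq_one_or_neg_one_of_mul_eq_one' hdet with ⟨h, h'⟩ | ⟨h, h'⟩ <;>
    simp [h, h'] at hg

/-- A hyperbolic element with positive lower left entry is conjugate to a companion matrix by an
affine map. -/
theorem companion_smul_affine (g : SL(2, ℤ)) (hg : (0 : ℝ) < (g 1 0 : ℤ)) (z : ℍ) :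
    companion (g 0 0 + g 1 1) • (-((g 0 0 : ℤ) : ℝ) +ᵥ (⟨(g 1 0 : ℤ), hg⟩ : {x : ℝ // 0 < x}) • z) =
      -((g 0 0 : ℤ) : ℝ) +ᵥ (⟨(g 1 0 : ℤ), hg⟩ : {x : ℝ // 0 < x}) • (g • z) := by
  have hdet : ((g 0 0 : ℤ) : ℂ) * (g 1 1 : ℤ) - (g 0 1 : ℤ) * (g 1 0 : ℤ) = 1 := by
    have : g 0 0 * g 1 1 - g 0 1 * g 1 0 = 1 := by rw [← det_fin_two]; exact g.det_coe
    exact_mod_cast this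
  have hd := sl_denom_ne_zero g z
  ext1
  rw [coe_sl_smul, coe_companion]
  simp only [UpperHalfPlane.coe_vadd, UpperHalfPlane.coe_pos_real_smul, coe_sl_smul,
    Complex.real_smul]
  simp only [of_apply, cons_val', cons_val_zero, cons_val_one, cons_val_fin_one]
  push_cast
  have hd' : (1 : ℂ) * (-(g 0 0 : ℤ) + (g 1 0 : ℤ) * z) + ((g 0 0 : ℤ) + (g 1 1 : ℤ)) =
      (g 1 0 : ℤ) * z + (g 1 1 : ℤ) := by ring
  rw [hd', div_eq_iff hd]
  field_simp
  linear_combination hdet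

/-- The conjugating affine map need not come from `PSL(2, ℤ)`, so primitivity may change, but as an
isometry of `ℍ` it preserves `L`. -/
theorem mem_primitiveLengthSpectrum_of_sl {g : SL(2, ℤ)} (hg : 0 < g 1 0) {L : ℝ} (hL : 0 < L)
    {c : ℝ → ℍ} (hc : IsGeodesicLine c) (h : ∀ t, g • c t = c (t + L)) :
    L ∈ primitiveLengthSpectrum := by
  have hg' : (0 : ℝ) < (g 1 0 : ℤ) := by exact_mod_cast hg
  refine ⟨companion (g 0 0 + g 1 1), isPrimitiveElement_companion (two_lt_abs_trace hL hc h), hL,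
    fun t => -((g 0 0 : ℤ) : ℝ) +ᵥ (⟨(g 1 0 : ℤ), hg'⟩ : {x : ℝ // 0 < x}) • c t,
    (UpperHalfPlane.isometry_real_vadd _).comp ((UpperHalfPlane.isometry_pos_mul _).comp hc),
    fun t => ?_⟩
  rw [coe_smul, companion_smul_affine g hg', h]

/-- Every length of a closed geodesic of the modular surface is the length of a primitive one. -/
theorem closedGeodesicLengths_subset (γ : PSL(2, ℤ)) :
    closedGeodesicLengths γ ⊆ primitiveLengthSpectrum := by
  rintro L ⟨hL, c, hc, h⟩
  obtain ⟨g, rfl⟩ := QuotientGroup.mk_surjective γ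
  replace h : ∀ t, g • c t = c (t + L) := h
  rcases (lower_left_ne_zero (two_lt_abs_trace hL hc h)).lt_or_gt with hneg | hpos
  -- `g` and `-g` act alike; the sign is chosen so that the affine map preserves `ℍ`.
  · refine mem_primitiveLengthSpectrum_of_sl (g := -g) ?_ hL hc
      fun t => by rw [ModularGroup.SL_neg_smul, h]
    rw [Matrix.SpecialLinearGroup.coe_neg, neg_apply]
    omega
  · exact mem_primitiveLengthSpectrum_of_sl hpos hL hc h

theorem nat_mul_mem_closedGeodesicLengths {γ : PSL(2, ℤ)} {L : ℝ}
    (hL : L ∈ closedGeodesicLengths γ) {n : ℕ} (hn : 0 < n) :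
    n * L ∈ closedGeodesicLengths (γ ^ n) := by
  obtain ⟨hL, c, hc, h⟩ := hL
  refine ⟨by positivity, c, hc, ?_⟩
  clear hn
  induction n with
  | zero => simp
  | succ n ih =>
    intro t
    rw [pow_succ, mul_smul, h, ih]
    push_cast
    ring_nf

end ModularSurface

theorem mainTheorem10 (ℓ : ℝ) (hℓ : ℓ ∈ ModularSurface.primitiveLengthSpectrum) (k : ℕ) :
    ∃ C : ℕ, 0 < C ∧
      ∀ n ∈ Finset.Icc 1 k, (C : ℝ) * n * ℓ ∈ ModularSurface.primitiveLengthSpectrum := by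
  obtain ⟨γ, -, hγ⟩ := hℓ
  refine ⟨1, one_pos, fun n hn => ?_⟩
  rw [Nat.cast_one, one_mul]
  exact ModularSurface.closedGeodesicLengths_subset (γ ^ n)
    (ModularSurface.nat_mul_mem_closedGeodesicLengths hγ (Finset.mem_Icc.mp hn).1)
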